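/- All graphs are simple and may be infinite. The Farey graph $F$ has vertex set $\mathbb{Q}\cup\{\infty\}$; writing its vertices as fractions in lowest terms (with $\infty=1/0$), two vertices $a/b$ and $c/d$ are adjacent if and only if $ad-bc=\pm1$. A $\Pi$-graph is a graph with more than one vertex that remains connected after the deletion of any finite set of edges (that is, it is infinitely edge-connected) and that does not contain, between any two distinct vertices, infinitely many independent paths (paths that pairwise meet only in their endvertices). A graph $H$ is a minor of a graph $G$ if $G$ contains pairwise disjoint, non-empty, connected (possibly infinite) vertex sets $B_w$, one for each vertex $w$ of $H$, such that $G$ has an edge between $B_w$ and $B_{w'}$ whenever $ww'$ is an edge of $H$. A graph is planar if it can be drawn in $\mathbb{R}^2$ with distinct vertices as distinct points and each edge as an arc between its endvertices such that no inner point of an edge is a vertex or lies on another edge. Proposition 3.1. There is a countable planar $\Pi$-graph that contains the Farey graph $F$ as an induced subgraph but is not a minor of $F$. -/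

import Mathlib

/-- Numerator of a point of `ℚ ∪ {∞}` in lowest terms, where `∞ = 1/0`. -/
def Farey.num : OnePoint ℚ → ℤ
  | none => 1
  | some q => q.num

/-- Denominator of a point of `ℚ ∪ {∞}` in lowest terms, where `∞ = 1/0`. -/
def Farey.den : OnePoint ℚ → ℤ
  | none => 0
  | some q => (q.den : ℤ)

/-- The Farey graph on `ℚ ∪ {∞}`: the points `a/b` and `c/d` (in lowest terms) are adjacent
if and only if `a * d - c * b = ± 1`. -/
def fareyGraph : SimpleGraph (OnePoint ℚ) where
  Adj x y :=
    Farey.num x * Farey.den y - Farey.num y * Farey.den x = 1 ∨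
      Farey.num x * Farey.den y - Farey.num y * Farey.den x = -1
  symm := ⟨fun x y h => by rcases h with h | h <;> [right; left] <;> linarith⟩
  loopless := ⟨fun x h => by rcases h with h | h <;> simp at h⟩

namespace SimpleGraph

/-- `H` is a minor of `G`: there are pairwise disjoint (possibly infinite) branch sets in `G`, one
for every vertex of `H`, each inducing a (non-empty) connected subgraph of `G`, such that `G` has
an edge between the branch sets of any two adjacent vertices of `H`. -/
def IsMinorOf {W V : Type*} (H : SimpleGraph W) (G : SimpleGraph V) : Prop :=
  ∃ B : W → Set V,
    (∀ w, (G.induce (B w)).Connected) ∧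
    (∀ w w', w ≠ w' → Disjoint (B w) (B w')) ∧
    (∀ w w', H.Adj w w' → ∃ x ∈ B w, ∃ y ∈ B w', G.Adj x y)

/-- A graph is infinitely edge-connected if it has more than one vertex and it stays connected
after the deletion of any finite set of edges, that is, it is `k`-edge-connected for all `k`. -/
def IsInfinitelyEdgeConnected {V : Type*} (G : SimpleGraph V) : Prop :=
  Nontrivial V ∧ ∀ k : ℕ, G.IsEdgeConnected k

/-- A set of `u`–`v` paths is independent if any two distinct paths in it meet only in their
endvertices. -/
def IndependentPaths {V : Type*} {G : SimpleGraph V} {u v : V} (S : Set (G.Path u v)) : Prop :=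
  ∀ P ∈ S, ∀ Q ∈ S, P ≠ Q →
    ∀ w, w ∈ (P : G.Walk u v).support → w ∈ (Q : G.Walk u v).support → w = u ∨ w = v

/-- A `Π`-graph is an infinitely edge-connected graph that does not contain infinitely many
independent paths between any two of its vertices. -/
def IsPiGraph {V : Type*} (G : SimpleGraph V) : Prop :=
  G.IsInfinitelyEdgeConnected ∧
    ∀ u v : V, u ≠ v → ∀ S : Set (G.Path u v), IndependentPaths S → S.Finite

/-- A drawing of the graph `G` in the plane: distinct vertices are distinct points, every edge
is an arc between its endvertices, and no inner point of an edge is a vertex or lies on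
another edge. -/
structure PlaneDrawing {V : Type*} (G : SimpleGraph V) where
  /-- The points that represent the vertices. -/
  point : V → EuclideanSpace ℝ (Fin 2)
  point_injective : Function.Injective point
  /-- The point sets that represent the edges. -/
  arc : G.edgeSet → Set (EuclideanSpace ℝ (Fin 2))
  /-- Every edge is the image of an injective path joining its endvertices. -/
  isArc : ∀ (u v : V) (h : G.Adj u v), ∃ γ : _root_.Path (point u) (point v),
    Function.Injective γ ∧ Set.range γ = arc ⟨s(u, v), h⟩
  /-- The only vertices on an edge are its endvertices. -/
  mem_of_point_mem : ∀ (e : G.edgeSet) (w : V), point w ∈ arc e → w ∈ (e : Sym2 V)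
  /-- Distinct edges meet only in vertices. -/
  inter_subset : ∀ e e' : G.edgeSet, e ≠ e' → arc e ∩ arc e' ⊆ Set.range point

/-- A graph is planar if it has a drawing in the plane. -/
def IsPlanar {V : Type*} (G : SimpleGraph V) : Prop :=
  Nonempty G.PlaneDrawing

end SimpleGraph

namespace FareyBook
open SimpleGraph

/-! The graph is a book: three copies of the Farey graph on the rationals of [0, 1], glued along the
edge 01. The ends 0, 1 and the three copies of 1/2 span a K_{2,3}. The Farey graph has no such
minor: by a Plücker identity for determinants no two of its edges cross in the cyclic order of ℚ ∪
{∞}, so disjoint connected sets cannot interleave, whereas a K_{2,3} model forces interleaving.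

Two pages already form the whole Farey graph: a/b ↦ |a|/(|a|+b) is unimodular on each sign class and
sends 0, ∞ to the shared ends. The third page adds no edge between these vertices.

Edge-connectivity holds because a deleted edge can be bypassed through its mediant, again and again.
Independent paths are finite in number because noncrossing edges yield, for any two vertices, a
finite separator up to the edge between them.

For planarity, page c is inscribed in the parabola y = c t(1 - t) and edges are chords. Chords of
one page meet only at vertices, since Farey intervals do not cross. Apart from the edge 01, no
interval straddles 1/2, so chords stay within a factor 2 of their parabola, and the slopes 1, -1, 4
keep the pages apart. -/

/-! ### Determinants, mediants and parents of rationals -/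

/-- The Farey determinant of two rationals; it is positive if and only if `s < t`. -/
def det (s t : ℚ) : ℤ := t.num * s.den - s.num * t.den

theorem det_pos {s t : ℚ} : 0 < det s t ↔ s < t := by
  rw [det, Rat.lt_iff, sub_pos]

theorem den_pos' (s : ℚ) : (0 : ℤ) < s.den := by exact_mod_cast s.pos

theorem det_mul_det (x z y w : ℚ) :
    det x y * det z w = det x z * det y w + det x w * det z y := by
  unfold det; ring

theorem den_mul_det (x y z : ℚ) : y.den * det x z = z.den * det x y + x.den * det y z := by
  unfold det; ring

/-- In `det_mul_det` the left side would be 1, while both products on the right are positive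
integers, so their sum is at least 2. -/
theorem not_crossing {x z y w : ℚ} (hxz : x < z) (hzy : z < y) (hyw : y < w)
    (hxy : det x y = 1) (hzw : det z w = 1) : False := by
  have h := det_mul_det x z y w
  have h1 := det_pos.2 hxz
  have h2 := det_pos.2 hyw
  have h3 := det_pos.2 hzy
  have h4 := det_pos.2 (hxz.trans (hzy.trans hyw))
  rw [hxy, hzw] at h
  nlinarith

/-- A rational strictly between two Farey neighbours has a larger denominator than both. -/
theorem den_add_le {x y z : ℚ} (h : det x z = 1) (hxy : x < y) (hyz : y < z) :
    x.den + z.den ≤ y.den := by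
  have h0 := den_mul_det x y z
  have h1 := det_pos.2 hxy
  have h2 := det_pos.2 hyz
  have h3 := den_pos' x
  have h4 := den_pos' z
  rw [h] at h0
  zify
  nlinarith

theorem exists_rat_num_den (a b : ℤ) (hb : 0 < b) (h : IsCoprime a b) :
    ∃ q : ℚ, q.num = a ∧ (q.den : ℤ) = b := by
  have h' : Nat.Coprime a.natAbs b.natAbs := Int.isCoprime_iff_nat_coprime.1 h
  exact ⟨a / b, Rat.num_div_eq_of_coprime hb h', Rat.den_div_eq_of_coprime hb h'⟩

theorem exists_mediant {x y : ℚ} (h : det x y = 1) :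
    ∃ m, x < m ∧ m < y ∧ det x m = 1 ∧ det m y = 1 := by
  obtain ⟨m, hn, hd⟩ := exists_rat_num_den (x.num + y.num) (x.den + y.den)
    (by have := den_pos' x; have := den_pos' y; omega)
    ⟨x.den, -x.num, by rw [← h, det]; ring⟩
  have h1 : det x m = 1 := by rw [← h, det, det, hn, hd]; ring
  have h2 : det m y = 1 := by rw [← h, det, det, hn, hd]; ring
  exact ⟨m, det_pos.1 (by omega), det_pos.1 (by omega), h1, h2⟩

theorem exists_parents {t : ℚ} (ht : 2 ≤ t.den) :
    ∃ p q : ℚ, det p t = 1 ∧ det t q = 1 ∧ det p q = 1 ∧ p.den < t.den ∧ q.den < t.den := by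
  obtain ⟨u, v, huv⟩ := t.isCoprime_num_den
  have hT : (2 : ℤ) ≤ t.den := by exact_mod_cast ht
  set T : ℤ := (t.den : ℤ)
  have hmod := Int.mul_ediv_add_emod u T
  have hlt := Int.emod_lt_of_pos u (by omega : 0 < T)
  have hge := Int.emod_nonneg u (by omega : T ≠ 0)
  set d := u % T
  set k := u / T
  have hd : 0 < d := by
    rcases hge.lt_or_eq with h | h
    · exact h
    · exfalso
      have h1 : T ∣ 1 := ⟨k * t.num + v, by rw [← huv, ← hmod, ← h]; ring⟩
      have := Int.le_of_dvd one_pos h1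
      omega
  -- Reducing the Bézout coefficient `u` modulo the denominator puts `d` strictly between 0 and `T`;
  -- `c` is the matching numerator. The other parent is the difference of `t` and `c / d` in
  -- numerators and denominators.
  set c := -(v + k * t.num)
  have key : t.num * d - c * T = 1 := by
    rw [← huv, ← hmod]; ring
  obtain ⟨p, hpn, hpd⟩ := exists_rat_num_den c d hd ⟨-T, t.num, by rw [← key]; ring⟩
  obtain ⟨q, hqn, hqd⟩ := exists_rat_num_den (t.num - c) (T - d) (by omega)
    ⟨T, -t.num, by rw [← key]; ring⟩
  refine ⟨p, q, ?_, ?_, ?_, ?_, ?_⟩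
  · rw [det, hpn, hpd, ← key]
  · rw [det, hqn, hqd, ← key]; ring
  · rw [det, hpn, hpd, hqn, hqd, ← key]; ring
  · zify; omega
  · zify; omega

theorem nonneg_of_det_eq_one {p t : ℚ} (h : det p t = 1) (ht : 0 < t) : 0 ≤ p := by
  by_contra! hp
  have h1 := Rat.num_neg.2 hp
  have h2 := Rat.num_pos.2 ht
  have h3 := den_pos' p
  have h4 := den_pos' t
  rw [det] at h
  nlinarith

theorem le_one_of_det_eq_one {t q : ℚ} (h : det t q = 1) (ht : t < 1) : q ≤ 1 := by
  by_contra! hq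
  have h1 := (Rat.lt_iff _ _).1 ht
  have h2 := (Rat.lt_iff _ _).1 hq
  have h3 := den_pos' t
  have h4 := den_pos' q
  simp at h1 h2
  rw [det] at h
  nlinarith

theorem two_le_den {t : ℚ} (h0 : 0 < t) (h1 : t < 1) : 2 ≤ t.den := by
  have h2 := Rat.num_pos.2 h0
  have h3 := (Rat.lt_iff _ _).1 h1
  simp at h3
  have := t.pos
  omega

/-! ### Finite cuts bound independent paths -/

/-- If the only edge between a set containing `u` but not `v` and its complement that avoids a
finite set of vertices is `uv`, then there are only finitely many independent `u`–`v` paths. -/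
theorem finite_of_independentPaths {V : Type*} {G : SimpleGraph V} {u v : V} (huv : u ≠ v)
    (A S : Set V) (hu : u ∈ A) (hv : v ∉ A) (hS : S.Finite) (huS : u ∉ S) (hvS : v ∉ S)
    (hcut : ∀ z ∈ A, ∀ w ∉ A, G.Adj z w → z ∈ S ∨ w ∈ S ∨ s(z, w) = s(u, v))
    (T : Set (G.Path u v)) (hT : IndependentPaths T) : T.Finite := by
  -- A path that uses the edge `uv` consists of that edge alone.
  have hedge : {P : G.Path u v | s(u, v) ∈ (P : G.Walk u v).edges}.Subsingleton := by
    have key : ∀ p : G.Walk u v, p.IsPath → s(u, v) ∈ p.edges →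
        p.support = [u, v] := by
      intro p hp he
      cases p with
      | nil => exact absurd rfl huv
      | @cons _ w _ h q =>
        rw [Walk.cons_isPath_iff] at hp
        rw [Walk.edges_cons, List.mem_cons] at he
        rcases he with he | he
        · have hw : v = w := by
            rcases Sym2.eq_iff.1 he with ⟨-, h⟩ | ⟨h1, h2⟩
            · exact h
            · exact absurd h2.symm huv
          subst hw
          have : q = Walk.nil := by
            cases q with
            | nil => rfl
            | cons h' q' =>
              have := (Walk.cons_isPath_iff _ _).1 hp.1
              exact absurd q'.end_mem_support this.2
          subst this
          rfl
        · exact absurd (q.fst_mem_support_of_mem_edges he) hp.2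
    intro P hP Q hQ
    apply Subtype.ext
    apply Walk.ext_support
    rw [key _ P.2 hP, key _ Q.2 hQ]
  have hcover : T ⊆ (⋃ s ∈ S, {P | P ∈ T ∧ s ∈ (P : G.Walk u v).support}) ∪
      {P : G.Path u v | s(u, v) ∈ (P : G.Walk u v).edges} := by
    intro P hP
    obtain ⟨d, hd, h1, h2⟩ := (P : G.Walk u v).exists_boundary_dart A hu hv
    rcases hcut _ h1 _ h2 d.adj with h | h | h
    · left
      exact Set.mem_biUnion h ⟨hP, Walk.dart_fst_mem_support_of_mem_darts _ hd⟩
    · left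
      exact Set.mem_biUnion h ⟨hP, Walk.dart_snd_mem_support_of_mem_darts _ hd⟩
    · right
      rw [Set.mem_ofPred_eq, ← h]
      exact List.mem_map.2 ⟨d, hd, rfl⟩
  -- By independence each vertex of `S`, being neither `u` nor `v`, lies on at most one path of `T`.
  refine Set.Finite.subset (Set.Finite.union (hS.biUnion fun s hs => ?_) hedge.finite) hcover
  apply Set.Subsingleton.finite
  rintro P ⟨hP, hsP⟩ Q ⟨hQ, hsQ⟩
  by_contra hne
  rcases hT P hP Q hQ hne s hsP hsQ with h | h
  · exact huS (h ▸ hs)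
  · exact hvS (h ▸ hs)

/-! ### Noncrossing and the absence of K_{2,3} minors -/

/-- The order of `ℚ ∪ {∞}` in which `∞` is the top element. -/
def key : OnePoint ℚ → WithTop ℚ
  | none => ⊤
  | some q => (q : WithTop ℚ)

theorem key_injective : Function.Injective key := by
  rintro (_ | x) (_ | y) h
  · rfl
  · exact absurd h.symm (WithTop.coe_ne_top)
  · exact absurd h (WithTop.coe_ne_top)
  · exact congrArg some (WithTop.coe_injective h)

/-- The determinant of two points of `ℚ ∪ {∞}`. -/
def det' (x y : OnePoint ℚ) : ℤ := Farey.num y * Farey.den x - Farey.num x * Farey.den y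

theorem det'_pos {x y : OnePoint ℚ} (h : key x < key y) : 0 < det' x y := by
  rcases x with _ | x <;> rcases y with _ | y
  · exact absurd h (lt_irrefl _)
  · exact absurd h not_top_lt
  · have := x.pos
    simpa [det', Farey.num, Farey.den] using this
  · have := (Rat.lt_iff _ _).1 (WithTop.coe_lt_coe.1 h)
    simpa [det', Farey.num, Farey.den] using this

theorem fareyGraph_not_crossing {x z y w : OnePoint ℚ} (hxz : key x < key z) (hzy : key z < key y)
    (hyw : key y < key w) (hxy : fareyGraph.Adj x y) (hzw : fareyGraph.Adj z w) : False := by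
  have e : det' x y * det' z w = det' x z * det' y w + det' x w * det' z y := by
    unfold det'; ring
  have h1 := det'_pos hxz
  have h2 := det'_pos hyw
  have h3 := det'_pos hzy
  have h4 := det'_pos (hxz.trans (hzy.trans hyw))
  have h5 := det'_pos (hxz.trans hzy)
  have h6 := det'_pos (hzy.trans hyw)
  have h7 : det' x y = 1 := by
    rcases hxy with h | h <;> unfold det' at * <;> omega
  have h8 : det' z w = 1 := by
    rcases hzw with h | h <;> unfold det' at * <;> omega
  rw [h7, h8] at e
  nlinarith

theorem exists_adj_of_induce_connected {V : Type*} {G : SimpleGraph V} {X : Set V}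
    (hX : (G.induce X).Connected) {a b : V} (ha : a ∈ X) (hb : b ∈ X) (A : Set V)
    (haA : a ∈ A) (hbA : b ∉ A) :
    ∃ p ∈ X, ∃ q ∈ X, p ∈ A ∧ q ∉ A ∧ G.Adj p q := by
  obtain ⟨w⟩ := hX.preconnected ⟨a, ha⟩ ⟨b, hb⟩
  obtain ⟨d, -, h1, h2⟩ := w.exists_boundary_dart {x : X | (x : V) ∈ A} haA hbA
  exact ⟨d.fst, d.fst.2, d.snd, d.snd.2, h1, h2, d.adj⟩

/-- Disjoint connected vertex sets of the Farey graph do not interleave. -/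
theorem not_interleaved {X Y : Set (OnePoint ℚ)} (hX : (fareyGraph.induce X).Connected)
    (hY : (fareyGraph.induce Y).Connected) (hd : Disjoint X Y) {x y x' y' : OnePoint ℚ}
    (hx : x ∈ X) (hy : y ∈ Y) (hx' : x' ∈ X) (hy' : y' ∈ Y)
    (h1 : key x < key y) (h2 : key y < key x') (h3 : key x' < key y') : False := by
  have hne : ∀ {a b}, a ∈ X → b ∈ Y → key a ≠ key b := fun ha hb h =>
    Set.disjoint_left.1 hd ha (key_injective h ▸ hb)
  -- Some edge `qp` inside `X` leaves the interval between `y` and `y'`. Its ends then separate `y`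
  -- from `y'`, so some edge inside `Y` crosses it.
  obtain ⟨q, hq, p, hp, hqI, hpI, hqp⟩ := exists_adj_of_induce_connected hX hx' hx
    {a | key y < key a ∧ key a < key y'} ⟨h2, h3⟩ (fun h => absurd h.1 h1.not_gt)
  have hpy : key p < key y ∨ key y' < key p := by
    by_contra! h
    exact hpI ⟨lt_of_le_of_ne h.1 (hne hp hy).symm, lt_of_le_of_ne h.2 (hne hp hy')⟩
  rcases hpy with hpy | hpy
  · obtain ⟨r, hr, s, hs, hrI, hsI, hrs⟩ := exists_adj_of_induce_connected hY hy hy'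
      {a | key p < key a ∧ key a < key q} ⟨hpy, hqI.1⟩ (fun h => absurd h.2 hqI.2.not_gt)
    rcases lt_or_gt_of_ne (hne hp hs) with h | h
    · rcases lt_or_gt_of_ne (hne hq hs) with h' | h'
      · exact fareyGraph_not_crossing hrI.1 hrI.2 h' hqp.symm hrs
      · exact hsI ⟨h, h'⟩
    · exact fareyGraph_not_crossing h hrI.1 hrI.2 hrs.symm hqp.symm
  · obtain ⟨r, hr, s, hs, hrI, hsI, hrs⟩ := exists_adj_of_induce_connected hY hy' hy
      {a | key q < key a ∧ key a < key p} ⟨hqI.2, hpy⟩ (fun h => absurd h.1 hqI.1.not_gt)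
    rcases lt_or_gt_of_ne (hne hq hs) with h | h
    · rcases lt_or_gt_of_ne (hne hp hs) with h' | h'
      · exact fareyGraph_not_crossing hrI.1 hrI.2 h' hqp hrs
      · exact hsI ⟨h, h'⟩
    · exact fareyGraph_not_crossing h hrI.1 hrI.2 hrs.symm hqp

/-- Among five distinct elements `a, b, c₀, c₁, c₂` of a linear order some pair `{a, cᵢ}`
interleaves some pair `{b, cⱼ}` with `i ≠ j`. -/
theorem exists_interleaved {α : Type*} [LinearOrder α] {a b : α} {c : Fin 3 → α}
    (hc : Function.Injective c) (ha : ∀ i, c i ≠ a) (hb : ∀ i, c i ≠ b) :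
    ∃ i j, i ≠ j ∧ ((a < c j ∧ c j < c i ∧ c i < b) ∨
      (c i < c j ∧ c j < a) ∨ (b < c i ∧ c i < c j) ∨ (c j < a ∧ b < c i)) := by
  -- Pigeonhole: two of the three `c`'s lie both inside or both outside the interval from `a` to
  -- `b`.
  obtain ⟨i, j, hij, h⟩ := Fintype.exists_ne_map_eq_of_card_lt
    (fun i => decide (a < c i ∧ c i < b)) (by simp)
  rw [decide_eq_decide] at h
  wlog hlt : c i < c j generalizing i j
  · exact this j i hij.symm h.symm
      (lt_of_le_of_ne (not_lt.1 hlt) fun e => hij (hc e.symm))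
  by_cases hi : a < c i ∧ c i < b
  · exact ⟨j, i, hij.symm, .inl ⟨hi.1, hlt, (h.1 hi).2⟩⟩
  · have hj := mt h.2 hi
    rcases lt_or_gt_of_ne (ha i) with h1 | h1
    · rcases lt_or_gt_of_ne (ha j) with h2 | h2
      · exact ⟨i, j, hij, .inr (.inl ⟨hlt, h2⟩)⟩
      · have h3 := lt_of_le_of_ne (not_lt.1 fun h3 => hj ⟨h2, h3⟩) (hb j).symm
        exact ⟨j, i, hij.symm, .inr (.inr (.inr ⟨h1, h3⟩))⟩
    · have h3 := lt_of_le_of_ne (not_lt.1 fun h3 => hi ⟨h1, h3⟩) (hb i).symm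
      exact ⟨i, j, hij, .inr (.inr (.inl ⟨h3, hlt⟩))⟩

/-- The Farey graph has no `K_{2,3}` minor. -/
theorem not_isMinorOf_fareyGraph {W : Type*} (H : SimpleGraph W) (a b : W) (c : Fin 3 → W)
    (hab : a ≠ b) (hc : Function.Injective c) (ha : ∀ i, H.Adj a (c i))
    (hb : ∀ i, H.Adj b (c i)) : ¬ H.IsMinorOf fareyGraph := by
  rintro ⟨B, hconn, hdisj, hadj⟩
  have hne : ∀ w, ∃ x, x ∈ B w := fun w => by
    obtain ⟨⟨x, hx⟩⟩ := (hconn w).nonempty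
    exact ⟨x, hx⟩
  choose f hf using hne
  have hkey : ∀ {w w'}, w ≠ w' → key (f w) ≠ key (f w') := fun {w w'} hw h =>
    Set.disjoint_left.1 (hdisj w w' hw) (hf w) (key_injective h ▸ hf w')
  wlog hlt : key (f a) < key (f b) generalizing a b
  · exact this b a hab.symm hb ha (lt_of_le_of_ne (not_lt.1 hlt) (hkey hab.symm))
  have hunion : ∀ w w', H.Adj w w' → (fareyGraph.induce (B w ∪ B w')).Connected := by
    intro w w' h
    obtain ⟨x, hx, y, hy, hxy⟩ := hadj w w' h
    exact connected_induce_union (hconn w).preconnected (hconn w').preconnected hx hy hxy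
  obtain ⟨i, j, hij, h⟩ := exists_interleaved (a := key (f a)) (b := key (f b))
    (c := fun i => key (f (c i)))
    (fun i j h => by
      by_contra hne
      exact hkey (hc.ne hne) h)
    (fun i => hkey (ha i).ne') (fun i => hkey (hb i).ne')
  have hX := hunion a (c i) (ha i)
  have hY := hunion b (c j) (hb j)
  -- Joining one `c` to `a` and a different one to `b` gives two disjoint connected sets; `i` and
  -- `j` were chosen to make them interleave.
  have hXY : Disjoint (B a ∪ B (c i)) (B b ∪ B (c j)) := by
    rw [Set.disjoint_union_left, Set.disjoint_union_right, Set.disjoint_union_right]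
    exact ⟨⟨hdisj _ _ hab, hdisj _ _ (ha j).ne⟩, hdisj _ _ (hb i).ne', hdisj _ _ (hc.ne hij)⟩
  have m1 : f a ∈ B a ∪ B (c i) := .inl (hf a)
  have m2 : f (c i) ∈ B a ∪ B (c i) := .inr (hf _)
  have m3 : f b ∈ B b ∪ B (c j) := .inl (hf b)
  have m4 : f (c j) ∈ B b ∪ B (c j) := .inr (hf _)
  rcases h with h | h | h | h
  · exact not_interleaved hX hY hXY m1 m4 m2 m3 h.1 h.2.1 h.2.2
  · exact not_interleaved hX hY hXY m2 m4 m1 m3 h.1 h.2 hlt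
  · exact not_interleaved hX hY hXY m1 m3 m2 m4 hlt h.1 h.2
  · exact not_interleaved hY hX hXY.symm m4 m1 m3 m2 h.1 hlt h.2

/-! ### The book of three pages -/

/-- Farey adjacency of rationals. -/
def FareyAdj (x y : ℚ) : Prop := det x y = 1 ∨ det y x = 1

theorem FareyAdj.symm {x y : ℚ} (h : FareyAdj x y) : FareyAdj y x := Or.symm h

theorem det_swap (x y : ℚ) : det y x = -det x y := by unfold det; ring

theorem FareyAdj.det_eq {x y : ℚ} (h : FareyAdj x y) (hxy : x < y) : det x y = 1 := by
  rcases h with h | h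
  · exact h
  · have := det_pos.2 hxy
    rw [det_swap] at h
    omega

theorem FareyAdj.ne {x y : ℚ} (h : FareyAdj x y) : x ≠ y := by
  rintro rfl
  rcases h with h | h <;> simp [det] at h

theorem FareyAdj.not_crossing {x z y w : ℚ} (hxy : FareyAdj x y) (hzw : FareyAdj z w)
    (h1 : x < z) (h2 : z < y) (h3 : y < w) : False :=
  FareyBook.not_crossing h1 h2 h3 (hxy.det_eq (h1.trans h2)) (hzw.det_eq (h2.trans h3))

/-- The slopes of the three pages of the book. -/
def IsSlope (c : ℚ) : Prop := c = 1 ∨ c = -1 ∨ c = 4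

/-- The points of the three curves `y = c * t * (1 - t)` with rational parameter
`t` between `0` and `1`. -/
def Vertex : Type :=
  {p : ℚ × ℚ // (0 ≤ p.1 ∧ p.1 ≤ 1) ∧ ∃ c, IsSlope c ∧ p.2 = c * (p.1 * (1 - p.1))}

/-- The first coordinate of a vertex. -/
def Vertex.t (v : Vertex) : ℚ := v.1.1

/-- The vertex `v` lies on the page of slope `c`. -/
def OnPage (c : ℚ) (v : Vertex) : Prop := v.1.2 = c * (v.t * (1 - v.t))

/-- The book of three half Farey graphs that share an edge. -/
def book : SimpleGraph Vertex where
  Adj u v := FareyAdj u.t v.t ∧ ∃ c, IsSlope c ∧ OnPage c u ∧ OnPage c v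
  symm := ⟨fun _ _ ⟨h, c, hc, h1, h2⟩ => ⟨h.symm, c, hc, h2, h1⟩⟩
  loopless := ⟨fun _ h => h.1.ne rfl⟩

/-- The vertex with parameter `t` on the page of slope `c`. -/
def pt (c : ℚ) (hc : IsSlope c) (t : ℚ) (ht : 0 ≤ t ∧ t ≤ 1) : Vertex :=
  ⟨(t, c * (t * (1 - t))), ht, c, hc, rfl⟩

theorem Vertex.exists_onPage (v : Vertex) : ∃ c, IsSlope c ∧ OnPage c v := v.2.2

theorem Vertex.ext_of_onPage {c : ℚ} {u v : Vertex} (hu : OnPage c u) (hv : OnPage c v)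
    (h : u.t = v.t) : u = v := by
  refine Subtype.ext (Prod.ext h ?_)
  rw [hu, hv, h]

/-- All three curves pass through (0, 0) and (1, 0), so using coordinates as vertices glues the
pages without a quotient. -/
theorem Vertex.ext_of_end {u v : Vertex} (h : u.t = v.t) (h0 : u.t = 0 ∨ u.t = 1) : u = v := by
  obtain ⟨c, -, hc⟩ := u.exists_onPage
  obtain ⟨d, -, hd⟩ := v.exists_onPage
  refine Subtype.ext (Prod.ext h ?_)
  rw [hc, hd, ← h]
  rcases h0 with h0 | h0 <;> simp [h0]

theorem OnPage.unique {c d : ℚ} {u : Vertex} (hc : OnPage c u) (hd : OnPage d u)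
    (h0 : 0 < u.t) (h1 : u.t < 1) : c = d := by
  unfold OnPage at hc hd
  have : 0 < u.t * (1 - u.t) := mul_pos h0 (by linarith)
  exact mul_right_cancel₀ this.ne' (hc.symm.trans hd)

instance : Countable Vertex := inferInstanceAs (Countable (Subtype _))

/-! ### Edge-connectivity -/

/-- Induction on the number of deleted pairs whose parameters lie in [x, y]. If the edge itself is
deleted, the detour through the mediant splits the problem into two intervals, neither of which
contains that edge, so both counts drop. -/
theorem reachable_of_det (s : Set (Sym2 Vertex)) (hs : s.Finite) (c : ℚ) (hc : IsSlope c) (n : ℕ) :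
    ∀ (x y : ℚ) (hx : 0 ≤ x ∧ x ≤ 1) (hy : 0 ≤ y ∧ y ≤ 1), det x y = 1 →
      {e ∈ s | ∀ v ∈ e, x ≤ v.t ∧ v.t ≤ y}.ncard ≤ n →
      (book.deleteEdges s).Reachable (pt c hc x hx) (pt c hc y hy) := by
  induction n with
  | zero =>
    intro x y hx hy h hn
    have hxy : x < y := det_pos.1 (by omega)
    rw [Nat.le_zero, Set.ncard_eq_zero (hs.subset (Set.sep_subset _ _))] at hn
    refine Adj.reachable (deleteEdges_adj.2 ⟨⟨.inl h, c, hc, rfl, rfl⟩, fun he => ?_⟩)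
    have : s(pt c hc x hx, pt c hc y hy) ∈ {e ∈ s | ∀ v ∈ e, x ≤ v.t ∧ v.t ≤ y} := by
      refine ⟨he, fun v hv => ?_⟩
      rcases Sym2.mem_iff.1 hv with rfl | rfl
      · exact ⟨le_rfl, hxy.le⟩
      · exact ⟨hxy.le, le_rfl⟩
    rw [hn] at this
    exact this
  | succ n ih =>
    intro x y hx hy h hn
    have hxy : x < y := det_pos.1 (by omega)
    by_cases he : s(pt c hc x hx, pt c hc y hy) ∈ s
    · obtain ⟨m, h1, h2, h3, h4⟩ := exists_mediant h
      have hmem : s(pt c hc x hx, pt c hc y hy) ∈ {e ∈ s | ∀ v ∈ e, x ≤ v.t ∧ v.t ≤ y} := by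
        refine ⟨he, fun v hv => ?_⟩
        rcases Sym2.mem_iff.1 hv with rfl | rfl
        · exact ⟨le_rfl, hxy.le⟩
        · exact ⟨hxy.le, le_rfl⟩
      have hlt : ∀ x' y', x ≤ x' → y' ≤ y → (x < x' ∨ y' < y) →
          {e ∈ s | ∀ v ∈ e, x' ≤ v.t ∧ v.t ≤ y'}.ncard ≤ n := by
        intro x' y' hx' hy' hor
        refine Nat.le_of_lt_succ (lt_of_lt_of_le (Set.ncard_lt_ncard ?_
          (hs.subset (Set.sep_subset _ _))) hn)
        refine ⟨fun e he => ⟨he.1, fun v hv => ⟨hx'.trans (he.2 v hv).1,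
          (he.2 v hv).2.trans hy'⟩⟩, fun hsub => ?_⟩
        have hm := (hsub hmem).2
        rcases hor with hor | hor
        · exact absurd (hm _ (Sym2.mem_mk_left _ _)).1 hor.not_ge
        · exact absurd (hm _ (Sym2.mem_mk_right _ _)).2 hor.not_ge
      have hm : 0 ≤ m ∧ m ≤ 1 := ⟨hx.1.trans h1.le, h2.le.trans hy.2⟩
      exact (ih x m hx hm h3 (hlt x m le_rfl h2.le (.inr h2))).trans
        (ih m y hm hy h4 (hlt m y h1.le le_rfl (.inl h1)))
    · exact Adj.reachable (deleteEdges_adj.2 ⟨⟨.inl h, c, hc, rfl, rfl⟩, he⟩)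

/-- Descent to the left parent, whose denominator is smaller. The vertex 1 has no parents in this
sense and uses the edge 01. -/
theorem reachable_zero (s : Set (Sym2 Vertex)) (hs : s.Finite) (c : ℚ) (hc : IsSlope c) (n : ℕ) :
    ∀ (x : ℚ) (hx : 0 ≤ x ∧ x ≤ 1), x.den ≤ n →
      (book.deleteEdges s).Reachable (pt c hc x hx) (pt c hc 0 ⟨le_rfl, zero_le_one⟩) := by
  induction n with
  | zero =>
    intro x _ h
    exact absurd x.pos (by omega)
  | succ n ih =>
    intro x hx hn
    rcases hx.1.eq_or_lt with rfl | h0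
    · rfl
    rcases hx.2.eq_or_lt with rfl | h1
    · exact (reachable_of_det s hs c hc _ 0 1 _ _ (by simp [det]) le_rfl).symm
    · obtain ⟨p, q, hp, -, -, hd, -⟩ := exists_parents (two_le_den h0 h1)
      have hpt : p < x := det_pos.1 (by omega)
      have hp' : 0 ≤ p ∧ p ≤ 1 := ⟨nonneg_of_det_eq_one hp h0, hpt.le.trans hx.2⟩
      exact (reachable_of_det s hs c hc _ p x hp' hx hp le_rfl).symm.trans
        (ih p hp' (by omega))

theorem book_isInfinitelyEdgeConnected : book.IsInfinitelyEdgeConnected := by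
  refine ⟨⟨pt 1 (.inl rfl) 0 ⟨le_rfl, zero_le_one⟩, pt 1 (.inl rfl) 1 ⟨zero_le_one, le_rfl⟩,
    fun h => zero_ne_one (congrArg Vertex.t h)⟩, fun k u v s hk => ?_⟩
  have hs : s.Finite := Set.finite_of_encard_le_coe hk.le
  have key : ∀ u : Vertex, (book.deleteEdges s).Reachable u
      (pt 1 (.inl rfl) 0 ⟨le_rfl, zero_le_one⟩) := by
    intro u
    obtain ⟨c, hc, hu⟩ := u.exists_onPage
    have h1 : u = pt c hc u.t u.2.1 := Vertex.ext_of_onPage hu rfl rfl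
    have h2 : pt 1 (.inl rfl) 0 ⟨le_rfl, zero_le_one⟩ = pt c hc 0 ⟨le_rfl, zero_le_one⟩ :=
      Vertex.ext_of_end rfl (.inl rfl)
    rw [h1, h2]
    exact reachable_zero s hs c hc _ _ _ le_rfl
  exact (key u).trans (key v).symm

/-! ### Independent paths -/

/-- Some finite vertex set together with the edge `uv` separates `u` from `v`. -/
def FinitelySeparated {V : Type*} (G : SimpleGraph V) (u v : V) : Prop :=
  ∃ A S : Set V, u ∈ A ∧ v ∉ A ∧ S.Finite ∧ u ∉ S ∧ v ∉ S ∧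
    ∀ z ∈ A, ∀ w ∉ A, G.Adj z w → z ∈ S ∨ w ∈ S ∨ s(z, w) = s(u, v)

theorem FinitelySeparated.symm {V : Type*} {G : SimpleGraph V} {u v : V}
    (h : FinitelySeparated G u v) : FinitelySeparated G v u := by
  obtain ⟨A, S, hu, hv, hS, huS, hvS, hcut⟩ := h
  refine ⟨Aᶜ, S, hv, fun h => h hu, hS, hvS, huS, fun z hz w hw hzw => ?_⟩
  rcases hcut w (not_not.1 hw) z hz hzw.symm with h | h | h
  · exact .inr (.inl h)
  · exact .inl h
  · exact .inr (.inr (by rw [Sym2.eq_swap, h, Sym2.eq_swap]))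

theorem finite_onPage (c : ℚ) {F : Set ℚ} (hF : F.Finite) :
    {z : Vertex | OnPage c z ∧ z.t ∈ F}.Finite :=
  Set.Finite.of_injOn (f := Vertex.t) (fun _ hz => hz.2)
    (fun _ hz _ hw h => Vertex.ext_of_onPage hz.1 hw.1 h) hF

/-- With `p`, `q` the parents of `u`, and `m`, `n` the mediants of `p, u` and `u, q`, the edges
`pm`, `nq` and `pq` fence in the interval (m, n): an edge leaving it on the page must end in one of
`p, q, m, n`. -/
theorem finitelySeparated_of_den_le {u v : Vertex} (h0 : 0 < u.t) (h1 : u.t < 1) (huv : u ≠ v)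
    (hden : v.t.den ≤ u.t.den) : FinitelySeparated book u v := by
  obtain ⟨c, hc, hu⟩ := u.exists_onPage
  obtain ⟨p, q, hpu, huq, hpq, -, -⟩ := exists_parents (two_le_den h0 h1)
  obtain ⟨m, hpm, hmu, dpm, dmu⟩ := exists_mediant hpu
  obtain ⟨n, hun, hnq, dun, dnq⟩ := exists_mediant huq
  have hp : 0 ≤ p := nonneg_of_det_eq_one hpu h0
  have hq : q ≤ 1 := le_one_of_det_eq_one huq h1
  -- Any other vertex of this page in [m, n] lies strictly between `u` and a parent, so its
  -- denominator exceeds that of `u`.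
  have hvin : OnPage c v → m ≤ v.t → v.t ≤ n → False := by
    intro hv hm hn
    rcases lt_trichotomy v.t u.t with h | h | h
    · have := den_add_le hpu (hpm.trans_le hm) h
      have := p.pos
      omega
    · exact huv (Vertex.ext_of_onPage hu hv h.symm)
    · have := den_add_le huq h (hn.trans_lt hnq)
      have := q.pos
      omega
  refine ⟨{z | OnPage c z ∧ m < z.t ∧ z.t < n},
    {z | OnPage c z ∧ z.t ∈ ({p, q, m, n} : Set ℚ)} \ {v}, ⟨hu, hmu, hun⟩,
    fun h => hvin h.1 h.2.1.le h.2.2.le, (finite_onPage c (Set.toFinite _)).sdiff, ?_,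
    fun h => h.2 rfl, ?_⟩
  · rintro ⟨⟨-, h⟩, -⟩
    rcases h with h | h | h | h
    · exact (hpm.trans hmu).ne' h
    · exact (hun.trans hnq).ne h
    · exact hmu.ne' h
    · exact hun.ne h
  rintro z ⟨hz, hmz, hzn⟩ w hw ⟨hzw, d, -, hzd, hwd⟩
  obtain rfl := hz.unique hzd (hp.trans_lt (hpm.trans hmz)) ((hzn.trans hnq).trans_le hq)
  by_cases hwF : w.t ∈ ({p, q, m, n} : Set ℚ)
  -- If `v` is a parent of `u` it is not available for the separator, but the edges `mu`, `un`,
  -- `pu`, `uq` block every edge from the interval to `v` except `uv`.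
  · by_cases hwv : w = v
    · subst hwv
      have hzu : z.t = u.t := by
        by_contra hne
        rcases lt_or_gt_of_ne hne with hlt | hlt
        · rcases hwF with h | h | h | h
          · exact FareyAdj.not_crossing (h ▸ hzw.symm) (.inl dmu) hpm hmz hlt
          · exact FareyAdj.not_crossing (.inl hpu) (h ▸ hzw) (hpm.trans hmz) hlt (hun.trans hnq)
          · exact hvin hwd h.ge (h.le.trans (hmu.trans hun).le)
          · exact hvin hwd ((hmu.trans hun).le.trans h.ge) h.le
        · rcases hwF with h | h | h | h
          · exact FareyAdj.not_crossing (h ▸ hzw.symm) (.inl huq) (hpm.trans hmu) hlt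
              (hzn.trans hnq)
          · exact FareyAdj.not_crossing (.inl dun) (h ▸ hzw) hlt hzn hnq
          · exact hvin hwd h.ge (h.le.trans (hmu.trans hun).le)
          · exact hvin hwd ((hmu.trans hun).le.trans h.ge) h.le
      rw [Vertex.ext_of_onPage hz hu hzu]
      exact .inr (.inr rfl)
    · exact .inr (.inl ⟨⟨hwd, hwF⟩, hwv⟩)
  · exfalso
    simp only [Set.mem_insert_iff, Set.mem_singleton_iff, not_or] at hwF
    obtain ⟨n1, n2, n3, n4⟩ := hwF
    rcases lt_or_gt_of_ne n1 with h | h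
    · exact FareyAdj.not_crossing hzw.symm (.inl hpq) h (hpm.trans hmz) (hzn.trans hnq)
    rcases lt_or_gt_of_ne n2 with h' | h'
    swap
    · exact FareyAdj.not_crossing (.inl hpq) hzw (hpm.trans hmz) (hzn.trans hnq) h'
    rcases lt_or_gt_of_ne n3 with h3 | h3
    · exact FareyAdj.not_crossing (.inl dpm) hzw.symm h h3 hmz
    rcases lt_or_gt_of_ne n4 with h4 | h4
    · exact hw ⟨hwd, h3, h4⟩
    · exact FareyAdj.not_crossing hzw (.inl dnq) hzn h4 h'

theorem fareyAdj_zero_half : FareyAdj 0 (1 / 2) := .inl (by norm_num [det])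

theorem fareyAdj_half_one : FareyAdj (1 / 2) 1 := .inl (by norm_num [det])

/-- An edge straddling 1/2 other than 01 would cross the edge from 0 to 1/2 or the one from 1/2 to
1. -/
theorem FareyAdj.half_dichotomy {x y : ℚ} (h : FareyAdj x y) (hx : 0 ≤ x) (hy : y ≤ 1)
    (hxy : x < y) : (x = 0 ∧ y = 1) ∨ y ≤ 1 / 2 ∨ 1 / 2 ≤ x := by
  by_contra! hne
  obtain ⟨h1, h2, h3⟩ := hne
  rcases hx.eq_or_lt with rfl | hx
  · exact h.not_crossing fareyAdj_half_one h3 h2 (lt_of_le_of_ne hy (h1 rfl))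
  · exact fareyAdj_zero_half.not_crossing h hx h3 h2

/-- The three copies of 1/2 separate the ends, up to the edge 01. -/
theorem finitelySeparated_ends {u v : Vertex} (hu : u.t = 0) (hv : v.t = 1) :
    FinitelySeparated book u v := by
  refine ⟨{z | z.t < 1 / 2}, ⋃ c ∈ ({1, -1, 4} : Set ℚ), {z | OnPage c z ∧ z.t ∈ ({1 / 2} : Set ℚ)},
    by simp [hu], by simp [hv]; norm_num,
    (Set.toFinite _).biUnion fun c _ => finite_onPage c (Set.toFinite _), ?_, ?_, ?_⟩
  · simp [hu]
  · simp [hv]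
  intro z hz w hw hzw
  have hz : z.t < 1 / 2 := hz
  have hw : 1 / 2 ≤ w.t := not_lt.1 hw
  rcases hzw.1.half_dichotomy z.2.1.1 w.2.1.2 (hz.trans_le hw) with ⟨h1, h2⟩ | h | h
  · right; right
    rw [Vertex.ext_of_end (h1.trans hu.symm) (.inl h1),
      Vertex.ext_of_end (h2.trans hv.symm) (.inr h2)]
  · right; left
    obtain ⟨c, hc, hwc⟩ := w.exists_onPage
    exact Set.mem_biUnion (x := c) hc ⟨hwc, le_antisymm h hw⟩
  · exact absurd hz h.not_gt

theorem book_finitelySeparated {u v : Vertex} (huv : u ≠ v) : FinitelySeparated book u v := by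
  wlog hden : v.t.den ≤ u.t.den generalizing u v
  · exact (this huv.symm (le_of_not_ge hden)).symm
  have hend : ∀ w : Vertex, ¬ (0 < w.t ∧ w.t < 1) → w.t = 0 ∨ w.t = 1 := by
    intro w h
    rcases w.2.1.1.eq_or_lt with h0 | h0
    · exact .inl h0.symm
    · exact .inr (le_antisymm w.2.1.2 (not_lt.1 fun h1 => h ⟨h0, h1⟩))
  by_cases hu : 0 < u.t ∧ u.t < 1
  · exact finitelySeparated_of_den_le hu.1 hu.2 huv hden
  have hu' := hend u hu
  have hv : ¬ (0 < v.t ∧ v.t < 1) := by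
    intro h
    have h2 := two_le_den h.1 h.2
    rcases hu' with h' | h' <;> rw [h'] at hden <;> simp at hden <;> omega
  rcases hu', hend v hv with ⟨h | h, h' | h'⟩
  · exact absurd (Vertex.ext_of_end (h.trans h'.symm) (.inl h)) huv
  · exact finitelySeparated_ends h h'
  · exact (finitelySeparated_ends h' h).symm
  · exact absurd (Vertex.ext_of_end (h.trans h'.symm) (.inr h)) huv

theorem book_isPiGraph : book.IsPiGraph := by
  refine ⟨book_isInfinitelyEdgeConnected, fun u v huv T hT => ?_⟩
  obtain ⟨A, S, hu, hv, hS, huS, hvS, hcut⟩ := book_finitelySeparated huv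
  exact finite_of_independentPaths huv A S hu hv hS huS hvS hcut T hT

/-! ### The book is not a minor of the Farey graph -/

theorem book_not_isMinorOf : ¬ book.IsMinorOf fareyGraph := by
  have hs : ∀ i, IsSlope ((![1, -1, 4] : Fin 3 → ℚ) i) := by
    intro i
    fin_cases i
    · exact .inl rfl
    · exact .inr (.inl rfl)
    · exact .inr (.inr rfl)
  have hh : (0 : ℚ) ≤ 1 / 2 ∧ (1 / 2 : ℚ) ≤ 1 := by norm_num
  refine not_isMinorOf_fareyGraph book (pt 1 (.inl rfl) 0 ⟨le_rfl, zero_le_one⟩)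
    (pt 1 (.inl rfl) 1 ⟨zero_le_one, le_rfl⟩) (fun i => pt _ (hs i) (1 / 2) hh)
    (fun h => zero_ne_one (congrArg Vertex.t h)) ?_ ?_ ?_
  · intro i j h
    have h2 := congrArg (fun v : Vertex => v.1.2) h
    simp only [pt] at h2
    have h3 := mul_right_cancel₀ (by norm_num) h2
    fin_cases i <;> fin_cases j <;> first | rfl | (norm_num at h3)
  · exact fun i => ⟨fareyAdj_zero_half, _, hs i, by simp [OnPage, Vertex.t, pt], rfl⟩
  · exact fun i => ⟨fareyAdj_half_one.symm, _, hs i, by simp [OnPage, Vertex.t, pt], rfl⟩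

/-! ### The Farey graph as an induced subgraph on two pages -/

theorem num_den_cases (x : OnePoint ℚ) :
    IsCoprime (Farey.num x) (Farey.den x) ∧
      (Farey.num x = 1 ∧ Farey.den x = 0 ∨ 0 < Farey.den x) := by
  rcases x with _ | q
  · exact ⟨isCoprime_one_left, .inl ⟨rfl, rfl⟩⟩
  · exact ⟨q.isCoprime_num_den, .inr (den_pos' q)⟩

theorem ext_num_den {x y : OnePoint ℚ} (h : Farey.num x = Farey.num y)
    (h' : Farey.den x = Farey.den y) : x = y := by
  rcases x with _ | x <;> rcases y with _ | y
  · rfl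
  · exact absurd h' (den_pos' y).ne
  · exact absurd h' (den_pos' x).ne'
  · exact congrArg some (Rat.ext h (Int.ofNat_inj.1 h'))

/-- Every point `a / b` of `ℚ ∪ {∞}` has a corresponding vertex of the book with parameter
`|a| / (|a| + b)`, on the page of slope `1` or `-1` according to the sign of `a`. -/
theorem exists_fold (x : OnePoint ℚ) :
    ∃ v : Vertex, v.t.num = |Farey.num x| ∧ (v.t.den : ℤ) = |Farey.num x| + Farey.den x ∧
      ∀ c : ℤ, OnPage c v ↔ Farey.num x * Farey.den x = c * (|Farey.num x| * Farey.den x) := by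
  obtain ⟨hcop, hcase⟩ := num_den_cases x
  set a := Farey.num x
  set b := Farey.den x
  have ha : 0 ≤ |a| := abs_nonneg a
  have hb : 0 ≤ b := by rcases hcase with h | h <;> omega
  have hpos : 0 < |a| + b := by
    rcases hcase with ⟨h, h'⟩ | h
    · rw [h, h']; norm_num
    · omega
  obtain ⟨r, s, hrs⟩ := hcop.abs_left
  obtain ⟨t, hn, hd⟩ := exists_rat_num_den |a| (|a| + b) hpos ⟨r - s, s, by rw [← hrs]; ring⟩
  have hpos' : (0 : ℚ) < (|a| : ℤ) + (b : ℚ) := by exact_mod_cast hpos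
  have ht : t = (|a| : ℤ) / ((|a| : ℤ) + (b : ℚ)) := by
    have h := Rat.num_div_den t
    have hd' : (t.den : ℚ) = (|a| : ℤ) + (b : ℚ) := by exact_mod_cast hd
    rw [← h, hn, hd']
  have hpage : ∀ c : ℤ, (a * b : ℚ) / ((|a| : ℤ) + (b : ℚ)) ^ 2 = c * (t * (1 - t)) ↔
      a * b = c * (|a| * b) := by
    intro c
    have h1 : t * (1 - t) = (|a| : ℤ) * b / ((|a| : ℤ) + (b : ℚ)) ^ 2 := by
      rw [ht]; field_simp; ring
    rw [h1, ← mul_div_assoc, div_left_inj' (by positivity)]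
    exact_mod_cast Iff.rfl
  -- The second coordinate is sign(a) · t(1 - t), written without a case split on the sign.
  refine ⟨⟨(t, (a * b : ℚ) / ((|a| : ℤ) + (b : ℚ)) ^ 2), ⟨?_, ?_⟩, ?_⟩, hn, hd, hpage⟩
  · exact Rat.num_nonneg.1 (hn ▸ ha)
  · rw [ht]
    refine div_le_one_of_le₀ ?_ hpos'.le
    have : (0 : ℚ) ≤ b := by exact_mod_cast hb
    linarith
  · rcases le_total 0 a with h | h
    · exact ⟨1, .inl rfl, by
        simpa using (hpage 1).2 (by rw [abs_of_nonneg h, one_mul])⟩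
    · exact ⟨-1, .inr (.inl rfl), by
        simpa using (hpage (-1)).2 (by rw [abs_of_nonpos h]; ring)⟩

/-- The embedding of the Farey graph into the book, on vertices. -/
noncomputable def fold (x : OnePoint ℚ) : Vertex := (exists_fold x).choose

theorem fold_num (x : OnePoint ℚ) : (fold x).t.num = |Farey.num x| := (exists_fold x).choose_spec.1

theorem fold_den (x : OnePoint ℚ) : ((fold x).t.den : ℤ) = |Farey.num x| + Farey.den x :=
  (exists_fold x).choose_spec.2.1

theorem onPage_fold (x : OnePoint ℚ) (c : ℤ) :
    OnPage c (fold x) ↔ Farey.num x * Farey.den x = c * (|Farey.num x| * Farey.den x) :=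
  (exists_fold x).choose_spec.2.2 c

theorem onPage_fold_one (x : OnePoint ℚ) : OnPage 1 (fold x) ↔ 0 ≤ Farey.num x := by
  have h := onPage_fold x 1
  rw [Int.cast_one] at h
  rw [h, one_mul]
  rcases (num_den_cases x).2 with ⟨h1, h2⟩ | h1
  · simp [h1, h2]
  · rw [mul_left_inj' h1.ne', eq_comm, abs_eq_self]

theorem onPage_fold_neg_one (x : OnePoint ℚ) :
    OnPage (-1) (fold x) ↔ Farey.num x ≤ 0 ∨ Farey.den x = 0 := by
  have h := onPage_fold x (-1)
  rw [Int.cast_neg, Int.cast_one] at h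
  rw [h, neg_one_mul, ← neg_mul, mul_eq_mul_right_iff, eq_neg_iff_add_eq_zero, ← eq_neg_iff_add_eq_zero,
    eq_comm, neg_eq_iff_eq_neg, abs_eq_neg_self]

/-- Only the shared ends, images of 0 and ∞, lie on the third page. Nonnegativity is all that is
needed to see that this page creates no new adjacency. -/
theorem onPage_fold_four (x : OnePoint ℚ) (h : OnPage 4 (fold x)) : 0 ≤ Farey.num x := by
  have h' := (onPage_fold x 4).1 (by exact_mod_cast h)
  rcases (num_den_cases x).2 with ⟨h1, h2⟩ | h1
  · omega
  · rw [← mul_assoc, mul_left_inj' h1.ne'] at h'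
    have := abs_nonneg (Farey.num x)
    omega

theorem fold_injective : Function.Injective fold := by
  intro x y h
  have hn : |Farey.num x| = |Farey.num y| := by rw [← fold_num, ← fold_num, h]
  have hd : Farey.den x = Farey.den y := by
    have h1 := fold_den x
    have h2 := fold_den y
    rw [h] at h1
    omega
  refine ext_num_den ?_ hd
  have h1 : 0 ≤ Farey.num x ↔ 0 ≤ Farey.num y := by
    rw [← onPage_fold_one, ← onPage_fold_one, h]
  by_cases h2 : 0 ≤ Farey.num x
  · rwa [abs_of_nonneg h2, abs_of_nonneg (h1.1 h2)] at hn
  · have h3 := mt h1.2 h2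
    rw [abs_of_neg (not_le.1 h2), abs_of_neg (not_le.1 h3)] at hn
    omega

theorem det_fold (x y : OnePoint ℚ) : det (fold x).t (fold y).t =
    |Farey.num y| * Farey.den x - |Farey.num x| * Farey.den y := by
  rw [det, fold_num, fold_num, fold_den, fold_den]; ring

theorem fareyAdj_fold_of_nonneg {x y : OnePoint ℚ} (hx : 0 ≤ Farey.num x)
    (hy : 0 ≤ Farey.num y) : FareyAdj (fold x).t (fold y).t ↔ fareyGraph.Adj x y := by
  rw [FareyAdj, det_fold, det_fold, abs_of_nonneg hx, abs_of_nonneg hy]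
  change _ ↔ (_ ∨ _)
  omega

theorem fareyAdj_fold_of_nonpos {x y : OnePoint ℚ} (hx : Farey.num x ≤ 0 ∨ Farey.den x = 0)
    (hy : Farey.num y ≤ 0 ∨ Farey.den y = 0) :
    FareyAdj (fold x).t (fold y).t ↔ fareyGraph.Adj x y := by
  rw [FareyAdj, det_fold, det_fold]
  change _ ↔ (_ ∨ _)
  have hnum : ∀ z, Farey.den z = 0 → Farey.num z = 1 := fun z hz =>
    (num_den_cases z).2.elim And.left fun h => absurd hz h.ne'
  rcases hx with hx | hx <;> rcases hy with hy | hy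
  · rw [abs_of_nonpos hx, abs_of_nonpos hy, neg_mul, neg_mul]; omega
  · rw [abs_of_nonpos hx, hy, hnum y hy]; simp only [mul_zero, abs_one, one_mul]; omega
  · rw [hx, abs_of_nonpos hy, hnum x hx]; simp only [mul_zero, abs_one, one_mul]; omega
  · simp [hx, hy]

/-- Otherwise the two products in the determinant have opposite signs, so their difference is at
least 2 in absolute value. Hence every Farey edge lies within one page. -/
theorem den_eq_zero_of_adj {x y : OnePoint ℚ} (h : fareyGraph.Adj x y) (hx : 0 < Farey.num x)
    (hy : Farey.num y < 0) : Farey.den x = 0 := by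
  have hdy : 0 < Farey.den y := by
    rcases (num_den_cases y).2 with h | h
    · omega
    · exact h
  rcases (num_den_cases x).2 with h1 | h1
  · exact h1.2
  · have h2 : 0 < Farey.num x * Farey.den y := mul_pos hx hdy
    have h3 : Farey.num y * Farey.den x < 0 := mul_neg_of_neg_of_pos hy h1
    rcases h with h | h <;> omega

theorem book_adj_fold {x y : OnePoint ℚ} : book.Adj (fold x) (fold y) ↔ fareyGraph.Adj x y := by
  constructor
  · rintro ⟨h, c, rfl | rfl | rfl, hx, hy⟩
    · exact (fareyAdj_fold_of_nonneg ((onPage_fold_one x).1 hx) ((onPage_fold_one y).1 hy)).1 h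
    · exact (fareyAdj_fold_of_nonpos ((onPage_fold_neg_one x).1 hx)
        ((onPage_fold_neg_one y).1 hy)).1 h
    · exact (fareyAdj_fold_of_nonneg (onPage_fold_four x hx) (onPage_fold_four y hy)).1 h
  · intro h
    have hpos : 0 ≤ Farey.num x → 0 ≤ Farey.num y → book.Adj (fold x) (fold y) := fun hx hy =>
      ⟨(fareyAdj_fold_of_nonneg hx hy).2 h, 1, .inl rfl, (onPage_fold_one x).2 hx,
        (onPage_fold_one y).2 hy⟩
    have hneg : (Farey.num x ≤ 0 ∨ Farey.den x = 0) → (Farey.num y ≤ 0 ∨ Farey.den y = 0) →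
        book.Adj (fold x) (fold y) := fun hx hy =>
      ⟨(fareyAdj_fold_of_nonpos hx hy).2 h, -1, .inr (.inl rfl), (onPage_fold_neg_one x).2 hx,
        (onPage_fold_neg_one y).2 hy⟩
    rcases lt_or_ge (Farey.num x) 0 with hx | hx <;> rcases lt_or_ge (Farey.num y) 0 with hy | hy
    · exact hneg (.inl hx.le) (.inl hy.le)
    · rcases hy.eq_or_lt with hy | hy
      · exact hneg (.inl hx.le) (.inl hy.ge)
      · exact hneg (.inl hx.le) (.inr (den_eq_zero_of_adj h.symm hy hx))
    · rcases hx.eq_or_lt with hx | hx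
      · exact hneg (.inl hx.ge) (.inl hy.le)
      · exact hneg (.inr (den_eq_zero_of_adj h hx hy)) (.inl hy.le)
    · exact hpos hx hy

/-! ### Planarity: chords of three parabolas -/

/-- The products measure how far each chord lies from the parabola. Overlapping Farey intervals are
nested, and at an interior point a strictly larger interval has the strictly larger product. -/
theorem FareyAdj.chord_meet {x y x' y' : ℚ} {ξ : ℝ} (h : FareyAdj x y) (h' : FareyAdj x' y')
    (hx : x ≤ ξ) (hy : ξ ≤ y) (hx' : x' ≤ ξ) (hy' : ξ ≤ y')
    (heq : (ξ - x) * (y - ξ) = (ξ - x') * (y' - ξ)) :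
    (ξ = x ∨ ξ = y) ∨ (x = x' ∧ y = y') := by
  rw [or_iff_not_imp_left]
  rintro hne
  rw [not_or] at hne
  have h1 : (x : ℝ) < ξ := lt_of_le_of_ne hx (Ne.symm hne.1)
  have h2 : ξ < y := lt_of_le_of_ne hy hne.2
  have hpos : 0 < (ξ - x) * (y - ξ) := mul_pos (by linarith) (by linarith)
  have h3 : (x' : ℝ) < ξ := lt_of_le_of_ne hx' (by
    rintro h
    rw [heq, h, sub_self, zero_mul] at hpos
    exact lt_irrefl _ hpos)
  have h4 : ξ < y' := lt_of_le_of_ne hy' (by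
    rintro h
    rw [heq, h, sub_self, mul_zero] at hpos
    exact lt_irrefl _ hpos)
  have h5 : x' < y := by exact_mod_cast h3.trans h2
  have h6 : x < y' := by exact_mod_cast h1.trans h4
  rcases lt_trichotomy x x' with hlt | rfl | hlt
  · have h7 : (y' : ℝ) ≤ y := by
      exact_mod_cast not_lt.1 fun h8 => h.not_crossing h' hlt h5 h8
    have h8 : (x : ℝ) < x' := by exact_mod_cast hlt
    nlinarith
  · refine ⟨rfl, ?_⟩
    have := mul_left_cancel₀ (by linarith : ξ - x ≠ 0) heq
    exact_mod_cast sub_left_injective this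
  · have h7 : (y : ℝ) ≤ y' := by
      exact_mod_cast not_lt.1 fun h8 => h'.not_crossing h hlt h6 h8
    have h8 : (x' : ℝ) < x := by exact_mod_cast hlt
    nlinarith

theorem depth_le {x y : ℚ} {ξ : ℝ} (hx0 : 0 ≤ x) (hy1 : y ≤ 1) (h : y ≤ 1 / 2 ∨ 1 / 2 ≤ x)
    (hx : x ≤ ξ) (hy : ξ ≤ y) : 2 * ((ξ - x) * (y - ξ)) ≤ ξ * (1 - ξ) := by
  have h1 : (0 : ℝ) ≤ x := by exact_mod_cast hx0
  have h2 : (y : ℝ) ≤ 1 := by exact_mod_cast hy1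
  rcases h with h | h
  · have h3 : (y : ℝ) ≤ 1 / 2 := by
      have : (y : ℝ) ≤ ((1 / 2 : ℚ) : ℝ) := by exact_mod_cast h
      simpa using this
    nlinarith [mul_nonneg h1 (by linarith : (0 : ℝ) ≤ y - ξ),
      mul_nonneg (by linarith : (0 : ℝ) ≤ ξ) (by linarith : (0 : ℝ) ≤ 1 / 2 - y)]
  · have h3 : 1 / 2 ≤ (x : ℝ) := by
      have : ((1 / 2 : ℚ) : ℝ) ≤ (x : ℝ) := by exact_mod_cast h
      simpa using this
    nlinarith [mul_nonneg (by linarith : (0 : ℝ) ≤ ξ - x) (by linarith : (0 : ℝ) ≤ 1 - y),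
      mul_nonneg (by linarith : (0 : ℝ) ≤ x - 1 / 2) (by linarith : (0 : ℝ) ≤ 1 - ξ)]

/-- Heights on the pages 1, -1, 4 fall into [P/2, P], [-P, -P/2] and [2P, 4P], which are disjoint
unless P = 0. A third slope of 2 would let the bands touch. -/
theorem IsSlope.eq_zero {c d : ℚ} (hc : IsSlope c) (hd : IsSlope d) (hcd : c ≠ d) {P δ ε : ℝ}
    (hδ : 0 ≤ δ) (hδ' : 2 * δ ≤ P) (hε : 0 ≤ ε) (hε' : 2 * ε ≤ P)
    (h : (c : ℝ) * (P - δ) = d * (P - ε)) : P = 0 := by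
  rcases hc with rfl | rfl | rfl <;> rcases hd with rfl | rfl | rfl <;>
    first
    | exact absurd rfl hcd
    | (push_cast at h; linarith)

theorem IsSlope.ne_zero {c : ℚ} (hc : IsSlope c) : (c : ℝ) ≠ 0 := by
  rcases hc with rfl | rfl | rfl <;> norm_num

/-- The position of a vertex in the plane. -/
def point (v : Vertex) : EuclideanSpace ℝ (Fin 2) := !₂[(v.1.1 : ℝ), (v.1.2 : ℝ)]

theorem point_injective : Function.Injective point := by
  intro u v h
  have h0 := congrFun (congrArg WithLp.ofLp h) 0
  have h1 := congrFun (congrArg WithLp.ofLp h) 1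
  simp only [point, Matrix.cons_val_zero, Matrix.cons_val_one, Rat.cast_inj] at h0 h1
  exact Subtype.ext (Prod.ext h0 h1)

theorem mem_segment_coords {c : ℚ} {u v : Vertex} (hu : OnPage c u) (hv : OnPage c v)
    (huv : u.t < v.t) {z : EuclideanSpace ℝ (Fin 2)} (hz : z ∈ segment ℝ (point u) (point v)) :
    u.t ≤ z 0 ∧ z 0 ≤ v.t ∧
      z 1 = c * (z 0 * (1 - z 0) - (z 0 - u.t) * (v.t - z 0)) := by
  obtain ⟨a, b, ha, hb, hab, rfl⟩ := hz
  have hlt : (u.t : ℝ) < v.t := by exact_mod_cast huv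
  have hu' : ((u.1.2 : ℚ) : ℝ) = c * (u.t * (1 - u.t)) := by rw [hu]; push_cast; rfl
  have hv' : ((v.1.2 : ℚ) : ℝ) = c * (v.t * (1 - v.t)) := by rw [hv]; push_cast; rfl
  have e0 : (a • point u + b • point v) 0 = a * u.t + b * v.t := by simp [point, Vertex.t]
  have e1 : (a • point u + b • point v) 1 = a * u.1.2 + b * v.1.2 := by simp [point]
  obtain rfl : a = 1 - b := by linarith
  rw [e0, e1, hu', hv']
  refine ⟨by nlinarith, by nlinarith, by ring⟩

/-- A normal form for the edges: the endvertices are listed from left to right. -/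
structure EdgeData (e : Sym2 Vertex) (u v : Vertex) (c : ℚ) : Prop where
  eq : e = s(u, v)
  lt : u.t < v.t
  adj : FareyAdj u.t v.t
  slope : IsSlope c
  left : OnPage c u
  right : OnPage c v

theorem exists_edgeData {e : Sym2 Vertex} (he : e ∈ book.edgeSet) :
    ∃ u v c, EdgeData e u v c := by
  induction e with
  | h u v =>
    obtain ⟨h, c, hc, hu, hv⟩ := he
    rcases lt_or_gt_of_ne h.ne with hlt | hlt
    · exact ⟨u, v, c, rfl, hlt, h, hc, hu, hv⟩
    · exact ⟨v, u, c, Sym2.eq_swap, hlt, h.symm, hc, hv, hu⟩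

/-- An edge lies on every page, or its chord stays close to its page's curve. -/
theorem EdgeData.dichotomy {e : Sym2 Vertex} {u v : Vertex} {c : ℚ} (h : EdgeData e u v c) :
    (∀ d, IsSlope d → EdgeData e u v d) ∨ v.t ≤ 1 / 2 ∨ 1 / 2 ≤ u.t := by
  rcases h.adj.half_dichotomy u.2.1.1 v.2.1.2 h.lt with ⟨h0, h1⟩ | h'
  · refine .inl fun d hd => ⟨h.eq, h.lt, h.adj, hd, ?_, ?_⟩
    · have := h.left
      simp only [OnPage, h0, zero_mul, mul_zero] at this ⊢
      exact this
    · have := h.right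
      simp only [OnPage, h1, sub_self, mul_zero] at this ⊢
      exact this
  · exact .inr h'

/-- The straight segment that represents an edge. -/
def arc (e : Sym2 Vertex) : Set (EuclideanSpace ℝ (Fin 2)) :=
  Sym2.lift ⟨fun u v => segment ℝ (point u) (point v), fun _ _ => segment_symm ℝ _ _⟩ e

theorem EdgeData.coords {e : Sym2 Vertex} {u v : Vertex} {c : ℚ} (h : EdgeData e u v c)
    {z : EuclideanSpace ℝ (Fin 2)} (hz : z ∈ arc e) :
    u.t ≤ z 0 ∧ z 0 ≤ v.t ∧ z 1 = c * (z 0 * (1 - z 0) - (z 0 - u.t) * (v.t - z 0)) := by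
  rw [h.eq] at hz
  exact mem_segment_coords h.left h.right h.lt hz

theorem eq_point {z : EuclideanSpace ℝ (Fin 2)} {v : Vertex} {c : ℚ} (hv : OnPage c v)
    (h0 : z 0 = v.t) (h1 : z 1 = c * (z 0 * (1 - z 0))) : z = point v := by
  ext i
  fin_cases i
  · exact h0
  · have : ((v.1.2 : ℚ) : ℝ) = c * (v.t * (1 - v.t)) := by rw [hv]; push_cast; rfl
    simp only [Fin.mk_one, point, Matrix.cons_val_one, this, h1, h0]
    simp

theorem EdgeData.same_page {e e' : Sym2 Vertex} {u v u' v' : Vertex} {c : ℚ}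
    (h : EdgeData e u v c) (h' : EdgeData e' u' v' c) {z : EuclideanSpace ℝ (Fin 2)}
    (hz : z ∈ arc e) (hz' : z ∈ arc e') : z ∈ Set.range point ∨ e = e' := by
  obtain ⟨a1, a2, a3⟩ := h.coords hz
  obtain ⟨b1, b2, b3⟩ := h'.coords hz'
  have heq := mul_left_cancel₀ h.slope.ne_zero (a3.symm.trans b3)
  rcases h.adj.chord_meet h'.adj a1 a2 b1 b2 (by linarith) with (hl | hr) | ⟨hl, hr⟩
  · exact .inl ⟨u, (eq_point h.left hl (by rw [a3, hl]; ring)).symm⟩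
  · exact .inl ⟨v, (eq_point h.right hr (by rw [a3, hr]; ring)).symm⟩
  · right
    rw [h.eq, h'.eq, Vertex.ext_of_onPage h.left h'.left hl,
      Vertex.ext_of_onPage h.right h'.right hr]

theorem arc_inter_arc {e e' : Sym2 Vertex} (he : e ∈ book.edgeSet) (he' : e' ∈ book.edgeSet)
    {z : EuclideanSpace ℝ (Fin 2)} (hz : z ∈ arc e) (hz' : z ∈ arc e') :
    z ∈ Set.range point ∨ e = e' := by
  obtain ⟨u, v, c, h⟩ := exists_edgeData he
  obtain ⟨u', v', c', h'⟩ := exists_edgeData he'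
  rcases h.dichotomy with hall | hd
  -- The edge 01 belongs to every page, so it can be compared on the page of the other edge.
  · exact (hall c' h'.slope).same_page h' hz hz'
  rcases h'.dichotomy with hall | hd'
  · exact h.same_page (hall c h.slope) hz hz'
  by_cases hc : c = c'
  · subst hc
    exact h.same_page h' hz hz'
  obtain ⟨a1, a2, a3⟩ := h.coords hz
  obtain ⟨b1, b2, b3⟩ := h'.coords hz'
  have δ := mul_nonneg (sub_nonneg.2 a1) (sub_nonneg.2 a2)
  have ε := mul_nonneg (sub_nonneg.2 b1) (sub_nonneg.2 b2)
  have hδ := depth_le (x := u.t) (y := v.t) u.2.1.1 v.2.1.2 hd a1 a2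
  have hε := depth_le (x := u'.t) (y := v'.t) u'.2.1.1 v'.2.1.2 hd' b1 b2
  have hP := h.slope.eq_zero h'.slope hc δ hδ ε hε (a3.symm.trans b3)
  have hz1 : z 1 = ((1 : ℚ) : ℝ) * (z 0 * (1 - z 0)) := by
    rw [a3, hP, show (z 0 - u.t) * (v.t - z 0) = 0 by linarith]
    simp
  left
  rcases mul_eq_zero.1 hP with h0 | h0
  · exact ⟨pt 1 (.inl rfl) 0 ⟨le_rfl, zero_le_one⟩,
      (eq_point (v := pt 1 (.inl rfl) 0 ⟨le_rfl, zero_le_one⟩) rfl (by simp [h0, pt, Vertex.t]) hz1).symm⟩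
  · exact ⟨pt 1 (.inl rfl) 1 ⟨zero_le_one, le_rfl⟩,
      (eq_point (v := pt 1 (.inl rfl) 1 ⟨zero_le_one, le_rfl⟩) rfl (by simp [pt, Vertex.t]; linarith) hz1).symm⟩

theorem mem_of_point_mem_arc {e : Sym2 Vertex} (he : e ∈ book.edgeSet) {w : Vertex}
    (hw : point w ∈ arc e) : w ∈ e := by
  obtain ⟨u, v, c, h⟩ := exists_edgeData he
  obtain ⟨d, hd, hwd⟩ := w.exists_onPage
  have hw1 : point w 1 = d * (point w 0 * (1 - point w 0)) := by
    have : ((w.1.2 : ℚ) : ℝ) = d * (w.t * (1 - w.t)) := by rw [hwd]; push_cast; rfl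
    exact this
  have hw0 : point w 0 = w.t := rfl
  have same : EdgeData e u v d → w ∈ e := by
    intro h
    obtain ⟨-, -, a3⟩ := h.coords hw
    have h0 := mul_left_cancel₀ hd.ne_zero (hw1.symm.trans a3)
    have h1 : (point w 0 - u.t) * (v.t - point w 0) = 0 := by linarith
    rw [h.eq, Sym2.mem_iff]
    rcases mul_eq_zero.1 h1 with h2 | h2
    · left
      refine Vertex.ext_of_onPage hwd h.left ?_
      rw [hw0, sub_eq_zero] at h2
      exact Rat.cast_inj.1 h2
    · right
      refine Vertex.ext_of_onPage hwd h.right ?_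
      rw [hw0, sub_eq_zero] at h2
      exact Rat.cast_inj.1 h2.symm
  rcases h.dichotomy with hall | hd'
  · exact same (hall d hd)
  by_cases hc : c = d
  · exact same (hc ▸ h)
  obtain ⟨a1, a2, a3⟩ := h.coords hw
  have δ := mul_nonneg (sub_nonneg.2 a1) (sub_nonneg.2 a2)
  have hδ := depth_le (x := u.t) (y := v.t) u.2.1.1 v.2.1.2 hd' a1 a2
  -- A vertex lies on its parabola, so it counts as a chord point of depth 0.
  have hP := h.slope.eq_zero hd hc δ hδ le_rfl (by linarith)
    (a3.symm.trans (hw1.trans (by rw [sub_zero])))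
  rw [hw0] at a1 a2 hP
  have a1' : u.t ≤ w.t := Rat.cast_le.1 a1
  have a2' : w.t ≤ v.t := Rat.cast_le.1 a2
  rw [h.eq, Sym2.mem_iff]
  rcases mul_eq_zero.1 hP with h0 | h0
  · have h0 : w.t = 0 := by exact_mod_cast h0
    exact .inl (Vertex.ext_of_end (by have := u.2.1.1; exact le_antisymm (h0 ▸ this) a1') (.inl h0))
  · have h0 : w.t = 1 := by
      have : (w.t : ℝ) = 1 := by linarith
      exact_mod_cast this
    exact .inr (Vertex.ext_of_end (le_antisymm a2' (h0 ▸ v.2.1.2)) (.inr h0))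

theorem book_isPlanar : book.IsPlanar :=
  ⟨{ point := point
     point_injective := point_injective
     arc := fun e => arc e
     isArc := fun u v h => by
      refine ⟨Path.segment (point u) (point v), ?_, ?_⟩
      · intro s t hst
        exact Subtype.ext (AffineMap.lineMap_injective ℝ (point_injective.ne h.ne) hst)
      · exact Path.range_segment _ _
     mem_of_point_mem := fun e w hw => mem_of_point_mem_arc e.2 hw
     inter_subset := fun e e' hne z hz =>
      (arc_inter_arc e.2 e'.2 hz.1 hz.2).resolve_right fun h => hne (Subtype.ext h) }⟩

end FareyBook

theorem proposition3p1 :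
    ∃ (V : Type) (G : SimpleGraph V),
      Countable V ∧
      G.IsPlanar ∧
      G.IsPiGraph ∧
      Nonempty (fareyGraph ↪g G) ∧
      ¬ G.IsMinorOf fareyGraph :=
  ⟨FareyBook.Vertex, FareyBook.book, inferInstance, FareyBook.book_isPlanar,
    FareyBook.book_isPiGraph, ⟨⟨⟨FareyBook.fold, FareyBook.fold_injective⟩,
      FareyBook.book_adj_fold⟩⟩, FareyBook.book_not_isMinorOf⟩
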